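/- **Definitions.** A *characteristic string* of length $n$ is an element $w=w_1\ldots w_n$ of $\{h,H,A\}^n$; slot $i\in\{1,\dots,n\}$ is *uniquely honest* if $w_i=h$, *multiply honest* if $w_i=H$, *adversarial* if $w_i=A$, and *honest* if $w_i\in\{h,H\}$. A *fork* for $w\in\{h,H,A\}^n$, written $F\vdash w$, is a finite rooted tree $F$ with all edges directed away from the root and with a vertex labeling $\ell:V(F)\to\{0,1,\dots,n\}$ such that (i) the root has label $0$; (ii) labels strictly increase along directed paths; (iii) each uniquely honest slot is the label of exactly one vertex, and each multiply honest slot is the label of at least one vertex; (iv) if $i<j$ are honest slots, then every vertex labeled $i$ has depth strictly less than every vertex labeled $j$. A *tine* of $F$ is a directed path starting at the root; its length is its number of edges. Two tines *diverge prior to slot $s$* if they contain different vertices labeled $s$, or if one contains a vertex labeled $s$ and the other does not. Let $s,k,T\in\mathbb N$. Slot $s$ is *$k$-settled* in $w\in\{h,H,A\}^T$ if, for every prefix $\hat w$ of $w$ with $|\hat w|\ge s+k$, no fork $F\vdash\hat w$ has two maximum-length tines that diverge prior to $s$. For a probability distribution $\mathcal D$ on $\{h,H,A\}^T$, the *$(s,k)$-settlement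 insecurity* is $$\mathbf S^{s,k}[\mathcal D]=\Pr_{w\sim\mathcal D}\bigl[\,s\text{ is not }k\text{-settled in }w\,\bigr].$$ Order $\{h,H,A\}$ by $h<H<A$ and $\{h,H,A\}^T$ coordinatewise. A distribution $\mathcal W$ on $\{h,H,A\}^T$ is *stochastically dominated* by $\mathcal B$, written $\mathcal W\preceq\mathcal B$, if $\mathcal W(S)\le\mathcal B(S)$ for every upward closed set $S\subseteq\{h,H,A\}^T$. For $\varepsilon\in(0,1)$ and $p_h\in[0,(1+\varepsilon)/2]$, a distribution on $\{h,H,A\}^T$ satisfies the *$(\varepsilon,p_h)$-Bernoulli condition* if the symbols $w_1,\dots,w_T$ are independent and each satisfies $\Pr[w_i=A]=(1-\varepsilon)/2$, $\Pr[w_i=h]=p_h$ and $\Pr[w_i=H]=1-(1-\varepsilon)/2-p_h$. **Theorem.** There is an absolute constant $c>0$ such that the following holds for all $\varepsilon,p_h\in(0,1)$ with $p_h\le(1+\varepsilon)/2$, all $s,k,T\in\mathbb N$, and every distribution $\mathcal B$ on $\{h,H,A\}^T$ satisfying the $(\varepsilon,p_h)$-Bernoulli condition: $$\mathbf S^{s,k}[\mathcal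 B]\le\exp\bigl(-k\cdot c\,\min(\varepsilon^3,\varepsilon^2p_h)\bigr).$$ Furthermore, $\mathbf S^{s,k}[\mathcal W]\le\mathbf S^{s,k}[\mathcal B]$ for every distribution $\mathcal W$ on $\{h,H,A\}^T$ with $\mathcal W\preceq\mathcal B$. -/

import Mathlib

open MeasureTheory ProbabilityTheory

namespace Settlement

/-- The alphabet of characteristic strings: `h` (a unique honest leader), `H` (one or more honest
leaders, no adversarial leader), `A` (at least one adversarial leader). -/
inductive CharSym : Type
  | h : CharSym
  | H : CharSym
  | A : CharSym
  deriving DecidableEq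

namespace CharSym

/-- Position of a symbol in the order `h < H < A`. -/
def rank : CharSym → ℕ
  | h => 0
  | H => 1
  | A => 2

theorem rank_injective : Function.Injective rank := by
  intro a b hab
  cases a <;> cases b <;> simp_all [rank]

instance : Fintype CharSym := ⟨{h, H, A}, by intro a; cases a <;> simp⟩

/-- The order `h < H < A`. Strings `Fin T → CharSym` then carry the coordinatewise order. -/
instance : LinearOrder CharSym := LinearOrder.lift' rank rank_injective

/-- Every set of symbols is measurable. Strings `Fin T → CharSym` then carry the product
`σ`-algebra, for which every set is measurable as well. -/
instance : MeasurableSpace CharSym := ⊤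

instance : DiscreteMeasurableSpace CharSym := ⟨fun _ => trivial⟩

end CharSym

/-- A characteristic string of length `n`. Slots are numbered from `1`: the symbol of slot `i + 1`
is `w i`. -/
abbrev CharString (n : ℕ) : Type := Fin n → CharSym

/-- `IsPathFrom edge r p`: the list of vertices `p` is a directed path (along `edge`) that starts
at `r`. -/
def IsPathFrom {V : Type} (edge : V → V → Prop) (r : V) (p : List V) : Prop :=
  p.head? = some r ∧ p.IsChain edge

/-- A finite directed tree with a root, all edges being directed away from the root
(each vertex is the end of exactly one directed path from the root), and with vertices labeled
by natural numbers. -/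
structure LabeledTree where
  /-- the vertices -/
  V : Type
  finite : Finite V
  /-- the root -/
  root : V
  /-- `edge u v`: there is an edge from `u` to `v` -/
  edge : V → V → Prop
  existsUnique_path : ∀ v : V, ∃! p : List V, IsPathFrom edge root p ∧ p.getLast? = some v
  /-- the label (slot number) of a vertex -/
  label : V → ℕ

namespace LabeledTree

variable (F : LabeledTree)

/-- Tines are the directed paths starting from the root. -/
def IsTine (p : List F.V) : Prop := IsPathFrom F.edge F.root p

/-- The length of a tine: its number of edges. -/
def tineLength {F : LabeledTree} (p : List F.V) : ℕ := p.length - 1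

/-- The unique tine that ends at `v`. -/
noncomputable def tineTo (v : F.V) : List F.V := (F.existsUnique_path v).choose

/-- The depth of `v`: the length of the unique tine that ends at `v`. -/
noncomputable def depth (v : F.V) : ℕ := tineLength (F.tineTo v)

/-- Maximum-length tines. -/
def IsMaxTine (p : List F.V) : Prop :=
  F.IsTine p ∧ ∀ q : List F.V, F.IsTine q → tineLength q ≤ tineLength p

/-- Two tines diverge prior to slot `s`: they contain different vertices labeled `s`, or one of them
contains a vertex labeled `s` while the other does not. -/
def DivergePriorTo (s : ℕ) (p q : List F.V) : Prop :=
  (∃ u ∈ p, ∃ v ∈ q, F.label u = s ∧ F.label v = s ∧ u ≠ v) ∨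
  ((∃ u ∈ p, F.label u = s) ∧ ¬ ∃ v ∈ q, F.label v = s) ∨
  ((∃ v ∈ q, F.label v = s) ∧ ¬ ∃ u ∈ p, F.label u = s)

/-- The tree has two maximum-length tines that diverge prior to slot `s`. -/
def HasDivergingMaxTines (s : ℕ) : Prop :=
  ∃ p q : List F.V, F.IsMaxTine p ∧ F.IsMaxTine q ∧ F.DivergePriorTo s p q

end LabeledTree

/-- `IsFork w F`: the labeled rooted tree `F` is a fork for the characteristic string `w`. -/
structure IsFork {n : ℕ} (w : CharString n) (F : LabeledTree) : Prop where
  /-- labels are slots in `{0, …, n}` -/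
  label_le : ∀ v : F.V, F.label v ≤ n
  /-- the root has label `0` -/
  label_root : F.label F.root = 0
  /-- labels strictly increase along directed paths -/
  label_lt : ∀ u v : F.V, F.edge u v → F.label u < F.label v
  /-- a uniquely honest slot is the label of exactly one vertex -/
  unique_honest : ∀ i : Fin n, w i = CharSym.h → ∃! v : F.V, F.label v = (i : ℕ) + 1
  /-- a multiply honest slot is the label of at least one vertex -/
  multi_honest : ∀ i : Fin n, w i = CharSym.H → ∃ v : F.V, F.label v = (i : ℕ) + 1
  /-- depths of vertices with honest labels strictly increase with the labels -/
  honest_depth : ∀ i j : Fin n, w i ≠ CharSym.A → w j ≠ CharSym.A → i < j →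
    ∀ u v : F.V, F.label u = (i : ℕ) + 1 → F.label v = (j : ℕ) + 1 → F.depth u < F.depth v

/-- Slot `s` is `k`-settled in the string `w`: no fork for a prefix of `w` of length at least
`s + k` has two maximum-length tines that diverge prior to `s`. -/
def IsSettled {T : ℕ} (s k : ℕ) (w : CharString T) : Prop :=
  ∀ (t : ℕ) (ht : t ≤ T), s + k ≤ t →
    ∀ F : LabeledTree, IsFork (Fin.take t ht w) F → ¬ F.HasDivergingMaxTines s

/-- The `(s, k)`-settlement insecurity of a distribution `D` on strings of length `T`: the
probability that, for the random string `w`, some fork for some prefix of `w` of length at least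
`s + k` has two maximum-length tines that diverge prior to slot `s`. -/
noncomputable def settlementInsecurity {T : ℕ} (s k : ℕ) (D : Measure (CharString T)) : ℝ :=
  D.real {w | ¬ IsSettled s k w}

/-- Stochastic dominance `ν ≼ μ`: monotone sets are at least as likely under `μ` as under `ν`. -/
def DominatedBy {Ω : Type*} [MeasurableSpace Ω] [Preorder Ω] (ν μ : Measure Ω) : Prop :=
  ∀ S : Set Ω, MeasurableSet S → IsUpperSet S → ν S ≤ μ S

/-- The symbol probabilities: `p_A = (1 - ε) / 2`, `p_h`, and `p_H = 1 - p_A - p_h`. -/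
noncomputable def symProb (ε ph : ℝ) : CharSym → ℝ
  | CharSym.h => ph
  | CharSym.H => 1 - (1 - ε) / 2 - ph
  | CharSym.A => (1 - ε) / 2

/-- The `(ε, p_h)`-Bernoulli condition on a distribution of strings `w` of length `T`: the symbols
of `w` are independent, and each of them is `h`, `H`, `A` with the probabilities above. -/
def BernoulliCondition {T : ℕ} (ε ph : ℝ) (D : Measure (CharString T)) : Prop :=
  iIndepFun (fun (i : Fin T) (w : CharString T) => w i) D ∧
    ∀ (i : Fin T) (a : CharSym), D.real {w | w i = a} = symProb ε ph a

end Settlement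

namespace Settlement

open CharSym

/-! Let a walk go up at honest slots and down at adversarial ones. Call a uniquely honest slot
Catalan if every interval of slots containing it has more honest than adversarial slots;
equivalently, the walk is at its running maximum just before the slot and never falls below the
height it has just after it.

A Catalan slot forces agreement (`IsFork.mem_of_isMaxTine`). The greatest honest depth grows by at
least one per honest slot, whereas a tine avoiding the Catalan vertex gains only adversarial
vertices between the honest vertices before and after that slot, so it falls behind. Hence every
longest tine passes through the Catalan vertex, and tines agree up to a common vertex. One Catalan
slot among `s + 1, …, s + k` therefore settles `s`.

The probability of having none is bounded by an exponential potential (`strP_not_hasCatalan_aux`): a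
factor `x` per unit of deficit below the running maximum, `lam` per slot of the window, and `φ ^ (z
+ 1)` for a future return below a candidate exceeded by `z`. At deficit zero each `h` is a
candidate, and it fails only if such a return occurs. The deficit entering the window has a bounded
exponential moment, whence the bound `2 * lam ^ k` (`strP_not_hasCatalan_le`); a covering argument
absorbs the 2 (`strP_not_hasCatalan_le_exp`).

The comparison of distributions holds because raising a symbol in `h < H < A` only relaxes the
conditions on forks (`IsFork.mono`). -/

/-! ### Expectations over random strings -/

/-- The expectation of `f` at a random list of `n` independent symbols with distribution `p`. -/
noncomputable def strE (p : CharSym → ℝ) : ℕ → (List CharSym → ℝ) → ℝ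
  | 0, f => f []
  | n + 1, f => p h * strE p n (fun l => f (h :: l)) + p H * strE p n (fun l => f (H :: l)) +
      p A * strE p n (fun l => f (A :: l))

/-- The probability that a random list of `n` independent symbols lies in `S`. -/
noncomputable def strP (p : CharSym → ℝ) (n : ℕ) (S : Set (List CharSym)) : ℝ :=
  strE p n (S.indicator 1)

/-- Nonnegative weights of total mass one on the alphabet. -/
structure IsSymProb (p : CharSym → ℝ) : Prop where
  nonneg : ∀ a, 0 ≤ p a
  sum_eq : p h + p H + p A = 1

section Expectation

variable {p : CharSym → ℝ}

theorem strE_mono (hp : IsSymProb p) {n : ℕ} {f g : List CharSym → ℝ}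
    (hfg : ∀ l : List CharSym, l.length = n → f l ≤ g l) : strE p n f ≤ strE p n g := by
  induction n generalizing f g with
  | zero => exact hfg [] rfl
  | succ n ih =>
    have key : ∀ a, p a * strE p n (fun l => f (a :: l)) ≤ p a * strE p n (fun l => g (a :: l)) :=
      fun a => mul_le_mul_of_nonneg_left (ih fun l hl => hfg _ (by simp [hl])) (hp.nonneg a)
    simp only [strE]
    linarith [key h, key H, key A]

theorem strE_congr (hp : IsSymProb p) {n : ℕ} {f g : List CharSym → ℝ}
    (hfg : ∀ l : List CharSym, l.length = n → f l = g l) : strE p n f = strE p n g :=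
  le_antisymm (strE_mono hp fun l hl => (hfg l hl).le) (strE_mono hp fun l hl => (hfg l hl).ge)

theorem strE_const (hp : IsSymProb p) (n : ℕ) (c : ℝ) : strE p n (fun _ => c) = c := by
  induction n with
  | zero => rfl
  | succ n ih => simp only [strE, ih]; rw [← add_mul, ← add_mul, hp.sum_eq, one_mul]

theorem strE_add (n : ℕ) (f g : List CharSym → ℝ) :
    strE p n (fun l => f l + g l) = strE p n f + strE p n g := by
  induction n generalizing f g with
  | zero => rfl
  | succ n ih => simp only [strE, ih]; ring

theorem strE_const_mul (n : ℕ) (c : ℝ) (f : List CharSym → ℝ) :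
    strE p n (fun l => c * f l) = c * strE p n f := by
  induction n generalizing f with
  | zero => rfl
  | succ n ih => simp only [strE, ih]; ring

theorem strE_sum (hp : IsSymProb p) {ι : Type*} (n : ℕ) (s : Finset ι)
    (f : ι → List CharSym → ℝ) :
    strE p n (fun l => ∑ i ∈ s, f i l) = ∑ i ∈ s, strE p n (f i) := by
  classical
  induction s using Finset.induction_on with
  | empty => simpa using strE_const hp n 0
  | insert i s hi ih => simp only [Finset.sum_insert hi, strE_add, ih]

theorem strE_append (m n : ℕ) (f : List CharSym → ℝ) :
    strE p (m + n) f = strE p m (fun l => strE p n (fun l' => f (l ++ l'))) := by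
  induction m generalizing f with
  | zero => simp [strE]
  | succ m ih => rw [Nat.succ_add]; simp only [strE, ih, List.cons_append]

theorem strE_concat (n : ℕ) (f : List CharSym → ℝ) :
    strE p (n + 1) f = p h * strE p n (fun l => f (l ++ [h])) +
      p H * strE p n (fun l => f (l ++ [H])) + p A * strE p n (fun l => f (l ++ [A])) := by
  rw [strE_append]
  simp only [strE, strE_add, strE_const_mul]

theorem strP_mono (hp : IsSymProb p) {n : ℕ} {S S' : Set (List CharSym)}
    (hS : ∀ l : List CharSym, l.length = n → l ∈ S → l ∈ S') : strP p n S ≤ strP p n S' := by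
  classical
  refine strE_mono hp fun l hl => ?_
  simp only [Set.indicator_apply, Pi.one_apply]
  split_ifs with h1 h2
  · exact le_rfl
  · exact absurd (hS l hl h1) h2
  · exact zero_le_one
  · exact le_rfl

theorem strP_univ (hp : IsSymProb p) (n : ℕ) : strP p n Set.univ = 1 := by
  simp only [strP, Set.indicator_univ]
  exact strE_const hp n 1

theorem strP_le_one (hp : IsSymProb p) (n : ℕ) (S : Set (List CharSym)) : strP p n S ≤ 1 :=
  (strP_mono hp fun _ _ _ => Set.mem_univ _).trans (strP_univ hp n).le

theorem strP_empty (hp : IsSymProb p) (n : ℕ) : strP p n ∅ = 0 := by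
  simp only [strP, Set.indicator_empty]
  exact strE_const hp n 0

theorem strP_setOf_mono (hp : IsSymProb p) {n : ℕ} {P Q : List CharSym → Prop}
    (hPQ : ∀ l : List CharSym, l.length = n → P l → Q l) :
    strP p n {l | P l} ≤ strP p n {l | Q l} :=
  strP_mono hp hPQ

theorem strP_succ (n : ℕ) (P : List CharSym → Prop) :
    strP p (n + 1) {l | P l} = p h * strP p n {l | P (h :: l)} + p H * strP p n {l | P (H :: l)} +
      p A * strP p n {l | P (A :: l)} := rfl

theorem strP_concat (n : ℕ) (P : List CharSym → Prop) :
    strP p (n + 1) {l | P l} = p h * strP p n {l | P (l ++ [h])} +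
      p H * strP p n {l | P (l ++ [H])} + p A * strP p n {l | P (l ++ [A])} := strE_concat n _

theorem strP_compl (hp : IsSymProb p) (n : ℕ) (S : Set (List CharSym)) :
    strP p n Sᶜ = 1 - strP p n S := by
  have h1 := strP_univ hp n
  have h2 : strP p n Set.univ = strP p n S + strP p n Sᶜ := by
    unfold strP
    rw [← strE_add]
    congr 1
    funext l
    simp
  linarith

theorem strP_union_le (hp : IsSymProb p) (n : ℕ) (S S' : Set (List CharSym)) :
    strP p n (S ∪ S') ≤ strP p n S + strP p n S' := by
  classical
  unfold strP
  rw [← strE_add]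
  refine strE_mono hp fun l _ => ?_
  simp only [Set.indicator_apply, Pi.one_apply, Set.mem_union]
  by_cases h1 : l ∈ S <;> by_cases h2 : l ∈ S' <;> simp [h1, h2]

end Expectation

/-! ### Walks and Catalan slots -/

/-- The step of the walk attached to a string: up at honest slots, down at adversarial ones. -/
def step : CharSym → ℤ
  | h => 1
  | H => 1
  | A => -1

theorem neg_one_le_step (a : CharSym) : -1 ≤ step a := by cases a <;> simp [step]

/-- The final position of the walk attached to a string. -/
def walk (l : List CharSym) : ℤ := (l.map step).sum

@[simp] theorem walk_nil : walk [] = 0 := rfl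

@[simp] theorem walk_cons (a : CharSym) (l : List CharSym) : walk (a :: l) = step a + walk l := by
  simp [walk]

@[simp] theorem walk_append (l l' : List CharSym) : walk (l ++ l') = walk l + walk l' := by
  simp [walk]

/-- The walk started at height `z` never becomes negative. -/
def StaysNonneg (z : ℕ) (l : List CharSym) : Prop := ∀ l', l' <+: l → 0 ≤ z + walk l'

/-- The walk ends at its maximum. -/
def EndsAtMax (l : List CharSym) : Prop := ∀ l', l' <:+ l → 0 ≤ walk l'

/-- Among the slots `s + 1, …, s + k` there is a uniquely honest one all of whose surrounding
intervals contain more honest than adversarial slots, where the past before the string is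
summarized by the requirement that the walk has to climb by `d` first. -/
def HasCatalan (d s k : ℕ) (l : List CharSym) : Prop :=
  ∃ l₁ l₂, l = l₁ ++ h :: l₂ ∧ s ≤ l₁.length ∧ l₁.length < s + k ∧ EndsAtMax l₁ ∧
    (d : ℤ) ≤ walk l₁ ∧ StaysNonneg 0 l₂

theorem EndsAtMax.cons {a : CharSym} {l : List CharSym} (hl : EndsAtMax l)
    (ha : 0 ≤ step a + walk l) : EndsAtMax (a :: l) := by
  intro l' hl'
  rcases List.suffix_cons_iff.1 hl' with rfl | hl'
  · simpa using ha
  · exact hl l' hl'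

theorem HasCatalan.cons {a : CharSym} {d d' k : ℕ} {l : List CharSym} (hl : HasCatalan d' 0 k l)
    (hd : (d : ℤ) ≤ step a + d') : HasCatalan d 0 (k + 1) (a :: l) := by
  obtain ⟨l₁, l₂, rfl, h1, h2, h3, h4, h5⟩ := hl
  refine ⟨a :: l₁, l₂, rfl, by simp, by simp; omega, h3.cons (by omega), ?_, h5⟩
  rw [walk_cons]
  omega

theorem hasCatalan_of_staysNonneg {k : ℕ} {l : List CharSym} (hl : StaysNonneg 0 l) :
    HasCatalan 0 0 (k + 1) (h :: l) := by
  refine ⟨[], l, rfl, by simp, by simp, ?_, by simp, hl⟩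
  intro l' hl'
  simp [List.suffix_nil.1 hl']

theorem not_hasCatalan_zero {d s : ℕ} {l : List CharSym} : ¬ HasCatalan d s 0 l := by
  rintro ⟨l₁, l₂, -, h1, h2, -⟩
  omega

theorem StaysNonneg.cons {a : CharSym} {z z' : ℕ} {l : List CharSym} (hl : StaysNonneg z' l)
    (hz : (z' : ℤ) = z + step a) : StaysNonneg z (a :: l) := by
  intro l' hl'
  rcases List.prefix_cons_iff.1 hl' with rfl | ⟨t, rfl, ht⟩
  · simp
  · have := hl t ht
    rw [walk_cons]
    omega

/-! ### Exponential decay of the probability of no Catalan slot -/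

section Decay

variable {p : CharSym → ℝ} {x lam φ : ℝ}

/-- Exponential decay of the probability that a window of length `k` contains no uniquely honest
Catalan slot, for walks with a deficit `d` from the past, and for walks that in addition
will return below a candidate slot which they currently exceed by `z`. -/
theorem strP_not_hasCatalan_aux (hp : IsSymProb p) (hx : 1 ≤ x) (hlam : 0 < lam) (hlam1 : lam ≤ 1)
    (hφ : 0 < φ) (h_inner : (p h + p H) / x + p A * x ≤ lam)
    (h_exc : x * ((p h + p H) * φ ^ 2 + p A) ≤ lam * φ)
    (h_zero : p h * φ + p H + p A * x ≤ lam) (N : ℕ) :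
    (∀ d k, k ≤ N → strP p N {l | ¬ HasCatalan d 0 k l} ≤ x ^ d * lam ^ k) ∧
    (∀ z d k, k ≤ N → strP p N {l | ¬ StaysNonneg z l ∧ ¬ HasCatalan d 0 k l} ≤
      φ ^ (z + 1) * (x ^ d * lam ^ k)) := by
  have hx0 : 0 < x := by linarith
  have hh := hp.nonneg h
  have hH := hp.nonneg H
  have hA := hp.nonneg A
  induction N with
  | zero =>
    constructor
    · intro d k hk
      obtain rfl : k = 0 := by omega
      exact (strP_le_one hp _ _).trans (by simpa using one_le_pow₀ hx)
    · intro z d k hk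
      refine le_trans (le_of_eq ?_) (by positivity : (0 : ℝ) ≤ _)
      have : ¬ ([] : List CharSym) ∈ {l | ¬ StaysNonneg z l ∧ ¬ HasCatalan d 0 k l} := by
        rintro ⟨h1, -⟩
        refine h1 fun l' hl' => ?_
        simp [List.prefix_nil.1 hl']
      simp only [strP, strE]
      exact Set.indicator_of_notMem this _
  | succ N ih =>
    obtain ⟨ih1, ih2⟩ := ih
    constructor
    · intro d k hk
      rcases k with _ | k
      · exact (strP_le_one hp _ _).trans (by simpa using one_le_pow₀ hx)
      have hk' : k ≤ N := by omega
      rw [strP_succ]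
      have bA : strP p N {l | ¬ HasCatalan d 0 (k + 1) (A :: l)} ≤
          x ^ (d + 1) * lam ^ k :=
        (strP_setOf_mono hp fun l _ hl (hl' : HasCatalan _ 0 k l) =>
          hl (hl'.cons (by simp [step]))).trans (ih1 (d + 1) k hk')
      -- At deficit zero the gain comes from `h` alone (`h_zero`); at positive deficit it comes from
      -- the upward drift (`h_inner`).
      rcases d with _ | d
      · have bH : strP p N {l | ¬ HasCatalan 0 0 (k + 1) (H :: l)} ≤ x ^ 0 * lam ^ k :=
          (strP_setOf_mono hp fun l _ hl (hl' : HasCatalan _ 0 k l) =>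
          hl (hl'.cons (by simp [step]))).trans (ih1 0 k hk')
        -- Without a Catalan slot, the candidate just read must fail, so the rest of the walk drops
        -- below it.
        have bh : strP p N {l | ¬ HasCatalan 0 0 (k + 1) (h :: l)} ≤
            φ ^ (0 + 1) * (x ^ 0 * lam ^ k) :=
          (strP_setOf_mono hp fun l _ hl => ⟨fun hl' => hl (hasCatalan_of_staysNonneg hl'),
            fun hl' : HasCatalan 0 0 k l => hl (hl'.cons (by simp [step]))⟩).trans (ih2 0 0 k hk')
        calc _ ≤ p h * (φ ^ (0 + 1) * (x ^ 0 * lam ^ k)) + p H * (x ^ 0 * lam ^ k) +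
              p A * (x ^ (0 + 1) * lam ^ k) := by gcongr
          _ = (p h * φ + p H + p A * x) * lam ^ k := by ring
          _ ≤ lam * lam ^ k := by gcongr
          _ = _ := by ring
      · have bH : ∀ a, step a = 1 →
            strP p N {l | ¬ HasCatalan (d + 1) 0 (k + 1) (a :: l)} ≤ x ^ d * lam ^ k :=
          fun a ha => (strP_setOf_mono hp fun l _ hl (hl' : HasCatalan d 0 k l) =>
            hl (hl'.cons (by rw [ha]; push_cast; omega))).trans (ih1 d k hk')
        have b1 := bH h rfl
        have b2 := bH H rfl
        calc _ ≤ p h * (x ^ d * lam ^ k) + p H * (x ^ d * lam ^ k) +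
              p A * (x ^ (d + 1 + 1) * lam ^ k) := by gcongr
          _ = ((p h + p H) / x + p A * x) * (x ^ (d + 1) * lam ^ k) := by
            field_simp
            ring
          _ ≤ lam * (x ^ (d + 1) * lam ^ k) := by gcongr
          _ = _ := by ring
    · intro z d k hk
      have hk' : k - 1 ≤ N := by omega
      -- During an excursion the deficit is pessimistically raised at every step, whatever the
      -- symbol; the factor `x` in `h_exc` pays for this. Truncated subtraction covers the case of
      -- an exhausted window.
      have hC : ∀ (a : CharSym) (l : List CharSym), ¬ HasCatalan d 0 k (a :: l) →
          ¬ HasCatalan (d + 1) 0 (k - 1) l := by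
        intro a l hl hl'
        rcases k with _ | k
        · exact not_hasCatalan_zero hl'
        · exact hl (hl'.cons (by have := neg_one_le_step a; push_cast; omega))
      have hpow : lam * lam ^ (k - 1) ≤ lam ^ k := by
        rcases k with _ | k
        · simpa using hlam1
        · simp [pow_succ, mul_comm]
      rw [strP_succ]
      have bH : ∀ a, step a = 1 →
          strP p N {l | ¬ StaysNonneg z (a :: l) ∧ ¬ HasCatalan d 0 k (a :: l)} ≤
            φ ^ (z + 1 + 1) * (x ^ (d + 1) * lam ^ (k - 1)) := by
        intro a ha
        refine (strP_setOf_mono hp fun l _ hl => ?_).trans (ih2 (z + 1) (d + 1) (k - 1) hk')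
        exact ⟨fun h' => hl.1 (h'.cons (by rw [ha]; push_cast; rfl)), hC a l hl.2⟩
      have bA : strP p N {l | ¬ StaysNonneg z (A :: l) ∧ ¬ HasCatalan d 0 k (A :: l)} ≤
            φ ^ z * (x ^ (d + 1) * lam ^ (k - 1)) := by
        -- From `z = 0` a down-step ends the excursion, and only the Catalan condition remains.
        rcases z with _ | z
        · rw [pow_zero, one_mul]
          exact (strP_setOf_mono hp fun l _ hl => hC A l hl.2).trans (ih1 (d + 1) (k - 1) hk')
        · refine (strP_setOf_mono hp fun l _ hl => ?_).trans (ih2 z (d + 1) (k - 1) hk')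
          exact ⟨fun h' => hl.1 (h'.cons (by simp [step])), hC A l hl.2⟩
      have b1 := bH h rfl
      have b2 := bH H rfl
      calc _ ≤ p h * (φ ^ (z + 1 + 1) * (x ^ (d + 1) * lam ^ (k - 1))) +
            p H * (φ ^ (z + 1 + 1) * (x ^ (d + 1) * lam ^ (k - 1))) +
            p A * (φ ^ z * (x ^ (d + 1) * lam ^ (k - 1))) := by gcongr
        _ = x * ((p h + p H) * φ ^ 2 + p A) * (φ ^ z * x ^ d * lam ^ (k - 1)) := by ring
        _ ≤ lam * φ * (φ ^ z * x ^ d * lam ^ (k - 1)) := by gcongr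
        _ = φ ^ (z + 1) * (x ^ d * (lam * lam ^ (k - 1))) := by ring
        _ ≤ _ := by gcongr

/-- How far the walk ends below its maximum. -/
def deficit (l : List CharSym) : ℕ := l.foldl (fun d a => ((d : ℤ) - step a).toNat) 0

theorem deficit_concat (l : List CharSym) (a : CharSym) :
    deficit (l ++ [a]) = ((deficit l : ℤ) - step a).toNat := by
  simp [deficit]

theorem neg_deficit_le_walk {l l' : List CharSym} (hl : l' <:+ l) : -(deficit l : ℤ) ≤ walk l' := by
  induction l using List.reverseRecOn generalizing l' with
  | nil => simp [List.suffix_nil.1 hl]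
  | append_singleton l a ih =>
    rw [deficit_concat]
    rcases List.suffix_concat_iff.1 hl with rfl | ⟨t, rfl, ht⟩
    · simp
    · have := ih ht
      simp only [walk_append, walk_cons, walk_nil]
      omega

theorem deficit_le_length (l : List CharSym) : deficit l ≤ l.length := by
  induction l using List.reverseRecOn with
  | nil => simp [deficit]
  | append_singleton l a ih =>
    have := neg_one_le_step a
    rw [deficit_concat, List.length_append, List.length_singleton]
    omega

/-- A suffix reaching back into `l` loses at most `deficit l` there, and the climb required of the
walk before the Catalan slot makes up for it. -/
theorem HasCatalan.append_left {l l' : List CharSym} {k : ℕ}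
    (hl : HasCatalan (deficit l) 0 k l') : HasCatalan 0 l.length k (l ++ l') := by
  obtain ⟨l₁, l₂, rfl, -, h2, h3, h4, h5⟩ := hl
  have hmax : EndsAtMax (l ++ l₁) := by
    intro t ht
    obtain ⟨u, hu⟩ := ht
    rcases List.append_eq_append_iff.1 hu with ⟨t', hl, rfl⟩ | ⟨t', rfl, hl⟩
    · have := neg_deficit_le_walk (l' := t') ⟨u, hl.symm⟩
      rw [walk_append]
      omega
    · exact h3 t ⟨t', hl.symm⟩
  exact ⟨l ++ l₁, l₂, by simp, by simp, by simpa using h2, hmax,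
    by simpa using hmax _ List.suffix_rfl, h5⟩

/-- The deficit is a walk reflected at zero with downward drift, and `hφ_le` makes the geometric
tail `φ ^ j` a supersolution of its recursion. -/
theorem strP_le_deficit (hp : IsSymProb p) (hφ : 0 < φ)
    (hφ_le : (p h + p H) * φ ^ 2 + p A ≤ φ) (n j : ℕ) :
    strP p n {l | j ≤ deficit l} ≤ φ ^ j := by
  have hh := hp.nonneg h
  have hH := hp.nonneg H
  have hA := hp.nonneg A
  induction n generalizing j with
  | zero =>
    rcases j with _ | j
    · simpa using strP_le_one hp _ _
    · have : ¬ ([] : List CharSym) ∈ {l | j + 1 ≤ deficit l} := by simp [deficit]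
      refine le_trans (le_of_eq ?_) (by positivity : (0 : ℝ) ≤ _)
      simp only [strP, strE]
      exact Set.indicator_of_notMem this _
  | succ n ih =>
    rcases j with _ | j
    · simpa using strP_le_one hp _ _
    have bH : ∀ a, step a = 1 →
        strP p n {l | j + 1 ≤ deficit (l ++ [a])} ≤ φ ^ (j + 2) := by
      intro a ha
      refine (strP_setOf_mono hp fun l _ hl => ?_).trans (ih (j + 2))
      simp only [deficit_concat, ha] at hl ⊢
      omega
    have bA : strP p n {l | j + 1 ≤ deficit (l ++ [A])} ≤ φ ^ j := by
      refine (strP_setOf_mono hp fun l _ hl => ?_).trans (ih j)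
      simp only [deficit_concat, step] at hl ⊢
      omega
    have b1 := bH h rfl
    have b2 := bH H rfl
    rw [strP_concat]
    calc _ ≤ p h * φ ^ (j + 2) + p H * φ ^ (j + 2) + p A * φ ^ j := by gcongr
      _ = ((p h + p H) * φ ^ 2 + p A) * φ ^ j := by ring
      _ ≤ φ * φ ^ j := by gcongr
      _ = _ := by ring

/-- Summing over the layers `j + 1 ≤ deficit l` with the tail bound gives a geometric series; `hxφ`
bounds its contribution by 1. -/
theorem strE_pow_deficit_le (hp : IsSymProb p) (hx : 1 ≤ x) (hφ : 0 < φ)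
    (hφ_le : (p h + p H) * φ ^ 2 + p A ≤ φ) (hxφ : (x - 1) * φ ≤ 1 - x * φ)
    (n : ℕ) : strE p n (fun l => x ^ deficit l) ≤ 2 := by
  classical
  have hx0 : 0 < x := by linarith
  have hpt : ∀ l : List CharSym, l.length = n → x ^ deficit l = 1 + ∑ j ∈ Finset.range n,
      (x - 1) * x ^ j * ({l | j + 1 ≤ deficit l} : Set (List CharSym)).indicator 1 l := by
    intro l hl
    have h1 : ∑ j ∈ Finset.range n,
        (x - 1) * x ^ j * ({l | j + 1 ≤ deficit l} : Set (List CharSym)).indicator 1 l =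
        ∑ j ∈ Finset.range (deficit l), (x - 1) * x ^ j := by
      have hd : deficit l ≤ n := hl ▸ deficit_le_length l
      rw [← Finset.sum_subset (Finset.range_subset_range.2 hd)]
      · refine Finset.sum_congr rfl fun j hj => ?_
        rw [Finset.mem_range] at hj
        rw [Set.indicator_of_mem (show l ∈ {l | j + 1 ≤ deficit l} from hj)]
        simp
      · intro j _ hj
        rw [Finset.mem_range, not_lt] at hj
        rw [Set.indicator_of_notMem, mul_zero]
        simpa [Nat.lt_succ_iff] using hj
    rw [h1, ← Finset.mul_sum, mul_comm, geom_sum_mul]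
    ring
  rw [strE_congr hp hpt, strE_add, strE_const hp, strE_sum hp]
  simp only [strE_const_mul]
  have hgeom : (∑ j ∈ Finset.range n, (x * φ) ^ j) * (1 - x * φ) ≤ 1 := by
    rw [geom_sum_mul_neg]
    have : 0 ≤ (x * φ) ^ n := by positivity
    linarith
  have hg0 : 0 ≤ ∑ j ∈ Finset.range n, (x * φ) ^ j := Finset.sum_nonneg fun j _ => by positivity
  have : ∑ j ∈ Finset.range n, (x - 1) * x ^ j *
      strE p n (({l | j + 1 ≤ deficit l} : Set (List CharSym)).indicator 1) ≤
      (x - 1) * φ * ∑ j ∈ Finset.range n, (x * φ) ^ j := by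
    rw [Finset.mul_sum]
    refine Finset.sum_le_sum fun j _ => ?_
    have hx1 : 0 ≤ x - 1 := by linarith
    calc _ ≤ (x - 1) * x ^ j * φ ^ (j + 1) := by
          gcongr
          exact strP_le_deficit hp hφ hφ_le n (j + 1)
      _ = _ := by ring
  have h3 := mul_le_mul_of_nonneg_right hxφ hg0
  nlinarith

/-- The first `s` symbols matter only through their deficit, so conditioning on them combines the
two previous estimates. -/
theorem strP_not_hasCatalan_le (hp : IsSymProb p) (hx : 1 ≤ x) (hlam : 0 < lam) (hlam1 : lam ≤ 1)
    (hφ : 0 < φ) (h_inner : (p h + p H) / x + p A * x ≤ lam)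
    (h_exc : x * ((p h + p H) * φ ^ 2 + p A) ≤ lam * φ)
    (h_zero : p h * φ + p H + p A * x ≤ lam) (hφ_le : (p h + p H) * φ ^ 2 + p A ≤ φ)
    (hxφ : (x - 1) * φ ≤ 1 - x * φ) {s k T : ℕ} (hT : s + k ≤ T) :
    strP p T {l | ¬ HasCatalan 0 s k l} ≤ 2 * lam ^ k := by
  obtain ⟨N, rfl⟩ := Nat.exists_eq_add_of_le (show s ≤ T by omega)
  unfold strP
  rw [strE_append]
  calc _ ≤ strE p s (fun l => lam ^ k * x ^ deficit l) := by
        refine strE_mono hp fun l hl => ?_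
        rw [mul_comm]
        refine le_trans ?_ ((strP_not_hasCatalan_aux hp hx hlam hlam1 hφ h_inner h_exc h_zero
          N).1 (deficit l) k (by omega))
        refine strP_mono (S := {l' | l ++ l' ∈ {l | ¬ HasCatalan 0 s k l}}) hp
          fun l' _ hl' hl'' => hl' ?_
        rw [← hl]
        exact hl''.append_left
    _ = lam ^ k * strE p s (fun l => x ^ deficit l) := strE_const_mul _ _ _
    _ ≤ lam ^ k * 2 := by
        gcongr
        exact strE_pow_deficit_le hp hx hφ hφ_le hxφ s
    _ = _ := mul_comm _ _

end Decay

/-! ### Translating windows and absorbing the prefactor -/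

theorem HasCatalan.of_append_right {l l' : List CharSym} {d s k : ℕ}
    (hl : HasCatalan d s k (l ++ l')) (hs : s + k ≤ l.length) : HasCatalan d s k l := by
  obtain ⟨l₁, l₂, he, h1, h2, h3, h4, h5⟩ := hl
  rcases List.append_eq_append_iff.1 he with ⟨t, rfl, -⟩ | ⟨t, rfl, ht⟩
  · simp at h2
    omega
  · rcases t with _ | ⟨a, t⟩
    · simp at hs
      omega
    · obtain ⟨rfl, rfl⟩ := List.cons_eq_cons.1 ht
      exact ⟨l₁, t, rfl, h1, h2, h3, h4, fun l'' hl'' => h5 l'' (hl''.trans (List.prefix_append _ _))⟩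

/-- Dropping a prefix only removes constraints on the walk before the slot. Hence shifting the
window to the right cannot increase the probability. -/
theorem HasCatalan.of_append_left {l l' : List CharSym} {s k : ℕ}
    (hl : HasCatalan 0 (l.length + s) k (l ++ l')) : HasCatalan 0 s k l' := by
  obtain ⟨l₁, l₂, he, h1, h2, h3, h4, h5⟩ := hl
  obtain ⟨t, rfl, rfl⟩ : ∃ t, l₁ = l ++ t ∧ l' = t ++ h :: l₂ := by
    rcases List.append_eq_append_iff.1 he with ⟨t, rfl, ht⟩ | ⟨t, rfl, ht⟩
    · exact ⟨t, rfl, ht⟩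
    · simp at h1
      obtain ⟨rfl, rfl⟩ : t = [] ∧ s = 0 := ⟨List.length_eq_zero_iff.1 (by omega), by omega⟩
      exact ⟨[], by simp, by simpa using ht.symm⟩
  have h3' : EndsAtMax t := fun l'' hl'' => h3 l'' (hl''.trans (List.suffix_append _ _))
  simp only [List.length_append] at h1 h2
  exact ⟨t, l₂, rfl, by omega, by omega, h3', by simpa using h3' t List.suffix_rfl, h5⟩

theorem HasCatalan.split {l : List CharSym} {d s k k' : ℕ} (hl : HasCatalan d s (k + k') l) :
    HasCatalan d s k l ∨ HasCatalan d (k + s) k' l := by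
  obtain ⟨l₁, l₂, he, h1, h2, h3⟩ := hl
  rcases lt_or_ge l₁.length (s + k) with h' | h'
  · exact Or.inl ⟨l₁, l₂, he, h1, h', h3⟩
  · exact Or.inr ⟨l₁, l₂, he, by omega, by omega, h3⟩

section Prefactor

variable {p : CharSym → ℝ}

theorem strP_add_le_left (hp : IsSymProb p) {m n : ℕ} {P Q : List CharSym → Prop}
    (hPQ : ∀ l l' : List CharSym, l.length = m → P (l ++ l') → Q l) :
    strP p (m + n) {l | P l} ≤ strP p m {l | Q l} := by
  unfold strP
  rw [strE_append]
  refine strE_mono hp fun l hl => ?_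
  by_cases hQ : Q l
  · rw [Set.indicator_of_mem (show l ∈ {l | Q l} from hQ)]
    exact strP_le_one hp n {l' | P (l ++ l')}
  · rw [Set.indicator_of_notMem (show l ∉ {l | Q l} from hQ)]
    refine le_trans ?_ (strP_empty hp n).le
    exact strP_mono (S := {l' | P (l ++ l')}) hp fun l' _ hl' => hQ (hPQ l l' hl hl')

theorem strP_add_le_right (hp : IsSymProb p) {m n : ℕ} {P Q : List CharSym → Prop}
    (hPQ : ∀ l l' : List CharSym, l.length = m → P (l ++ l') → Q l') :
    strP p (m + n) {l | P l} ≤ strP p n {l | Q l} := by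
  unfold strP
  rw [strE_append, ← strE_const hp m (strE p n _)]
  exact strE_mono hp fun l hl =>
    strP_setOf_mono (P := fun l' => P (l ++ l')) hp fun l' _ hl' => hPQ l l' hl hl'

/-- A long window is covered by translates of a short one. -/
theorem strP_hasCatalan_mul_le (hp : IsSymProb p) {s n T : ℕ} (hT : s + n ≤ T) (j : ℕ) :
    strP p (T + n * j) {l | HasCatalan 0 s (n * (j + 1)) l} ≤
      (j + 1) * strP p T {l | HasCatalan 0 s n l} := by
  induction j with
  | zero => simp
  | succ j ih =>
    have h1 : strP p (T + n * (j + 1)) {l | HasCatalan 0 s n l} ≤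
        strP p T {l | HasCatalan 0 s n l} :=
      strP_add_le_left hp fun l l' hl hl' => hl'.of_append_right (by omega)
    have h2 : strP p (n + (T + n * j)) {l | HasCatalan 0 (n + s) (n * (j + 1)) l} ≤
        strP p (T + n * j) {l | HasCatalan 0 s (n * (j + 1)) l} :=
      strP_add_le_right hp fun l l' hl hl' => HasCatalan.of_append_left (l := l) (hl ▸ hl')
    have h3 : strP p (T + n * (j + 1)) {l | HasCatalan 0 s (n * (j + 1 + 1)) l} ≤
        strP p (T + n * (j + 1)) {l | HasCatalan 0 s n l} +
          strP p (T + n * (j + 1)) {l | HasCatalan 0 (n + s) (n * (j + 1)) l} := by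
      refine le_trans (strP_mono hp fun l _ hl => ?_) (strP_union_le hp _ _ _)
      exact HasCatalan.split (by rwa [← mul_one_add, add_comm 1])
    rw [show n + (T + n * j) = T + n * (j + 1) by ring] at h2
    push_cast
    linarith

theorem strP_not (hp : IsSymProb p) (n : ℕ) (P : List CharSym → Prop) :
    strP p n {l | ¬ P l} = 1 - strP p n {l | P l} := strP_compl hp n {l | P l}

/-- A constant prefactor in an exponential bound that holds for all windows can be absorbed
into the rate. -/
theorem strP_not_hasCatalan_le_exp (hp : IsSymProb p) {m : ℝ} (hm : 0 < m)
    (hbound : ∀ s k T : ℕ, s + k ≤ T →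
      strP p T {l | ¬ HasCatalan 0 s k l} ≤ 2 * Real.exp (-(k * m)))
    {s k T : ℕ} (hT : s + k ≤ T) :
    strP p T {l | ¬ HasCatalan 0 s k l} ≤ Real.exp (-(k * (m / 8))) := by
  rcases Nat.eq_zero_or_pos k with rfl | hk
  · simpa using strP_le_one hp _ _
  have hk' : (0 : ℝ) < k := Nat.cast_pos.2 hk
  have hkm : 0 < k * m := by positivity
  rcases le_or_gt 2 (k * m) with hbig | hsmall
  · have h1 : (2 : ℝ) ≤ Real.exp 1 := by linarith [Real.add_one_le_exp (1 : ℝ)]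
    calc _ ≤ 2 * Real.exp (-(k * m)) := hbound s k T hT
      _ ≤ Real.exp 1 * Real.exp (-(k * m)) := by gcongr
      _ = Real.exp (1 + -(k * m)) := (Real.exp_add _ _).symm
      _ ≤ _ := Real.exp_le_exp.2 (by linarith)
  -- For a short window, `j + 1` translates have total exponent between 2 and 4. Over the enlarged
  -- window failure has probability at most 1/2, so one window succeeds with probability at least `1
  -- / (2 * (j + 1))`, hence at least `k * m / 8`.
  · obtain ⟨j, hj1, hj2⟩ : ∃ j : ℕ, 2 ≤ (j + 1) * (k * m) ∧ j * (k * m) ≤ 2 := by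
      refine ⟨⌊2 / (k * m)⌋₊, ?_, ?_⟩
      · rw [← div_le_iff₀ hkm]
        exact (Nat.lt_floor_add_one _).le
      · rw [← le_div_iff₀ hkm]
        exact Nat.floor_le (by positivity)
    have h1 := strP_hasCatalan_mul_le hp hT j
    have h2 := hbound s (k * (j + 1)) (T + k * j) (by nlinarith)
    rw [strP_not hp] at h2 ⊢
    have h3 : Real.exp (-(((k * (j + 1) : ℕ) : ℝ) * m)) ≤ 1 / 4 := by
      have h4 : (2 : ℝ) ≤ Real.exp 1 := by linarith [Real.add_one_le_exp (1 : ℝ)]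
      have h5 : (4 : ℝ) ≤ Real.exp (((k * (j + 1) : ℕ) : ℝ) * m) := by
        calc (4 : ℝ) = 2 * 2 := by norm_num
          _ ≤ Real.exp 1 * Real.exp 1 := by gcongr
          _ = Real.exp (1 + 1) := (Real.exp_add _ _).symm
          _ ≤ _ := Real.exp_le_exp.2 (by push_cast; linarith)
      rw [Real.exp_neg, ← one_div]
      exact one_div_le_one_div_of_le (by norm_num) h5
    have h6 : k * (m / 8) ≤ strP p T {l | HasCatalan 0 s k l} := by
      have h7 : (1 / 2 : ℝ) ≤ (j + 1) * strP p T {l | HasCatalan 0 s k l} := by linarith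
      have h8 : ((j : ℝ) + 1) * (k * (m / 8)) ≤ 1 / 2 := by linarith
      exact le_of_mul_le_mul_left (h8.trans h7) (by positivity)
    linarith [Real.add_one_le_exp (-(k * (m / 8)))]

end Prefactor

/-! ### Choice of the parameters -/

theorem isSymProb_symProb {ε ph : ℝ} (hε1 : ε < 1) (hph0 : 0 < ph)
    (hph : ph ≤ (1 + ε) / 2) : IsSymProb (symProb ε ph) where
  nonneg a := by cases a <;> simp only [symProb] <;> linarith
  sum_eq := by simp only [symProb]; ring

theorem strP_symProb_not_hasCatalan_le {ε ph : ℝ} (hε0 : 0 < ε) (hε1 : ε < 1) (hph0 : 0 < ph)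
    (hph : ph ≤ (1 + ε) / 2) {s k T : ℕ} (hT : s + k ≤ T) :
    strP (symProb ε ph) T {l | ¬ HasCatalan 0 s k l} ≤
      Real.exp (-((k : ℝ) * (1 / 64 * min (ε ^ 3) (ε ^ 2 * ph)))) := by
  have hp := isSymProb_symProb hε1 hph0 hph
  -- The bound `μ ≤ ε ^ 2` serves the excursion inequality, and `μ ≤ ε * ph` the one at deficit
  -- zero. The drift `ε` contributes the remaining factor of the rate `ε * μ`.
  set μ := min (ε ^ 2) (ε * ph) with hμ
  have hm : min (ε ^ 3) (ε ^ 2 * ph) = ε * μ := by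
    rw [hμ, mul_min_of_nonneg _ _ hε0.le]
    congr 1 <;> ring
  have hμ0 : 0 < μ := lt_min (by positivity) (by positivity)
  have hμ1 : μ ≤ ε ^ 2 := min_le_left _ _
  have hμ2 : μ ≤ ε * ph := min_le_right _ _
  have hε2 : ε ^ 2 < ε := by nlinarith
  have hεμ : ε * μ < μ := by nlinarith
  have hεμ0 : 0 < ε * μ := by positivity
  have hμ3 : ε ^ 2 * μ < μ := by nlinarith
  have hq : symProb ε ph h + symProb ε ph H = (1 + ε) / 2 := by simp only [symProb]; ring
  have hA : symProb ε ph A = (1 - ε) / 2 := rfl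
  have key : (symProb ε ph h + symProb ε ph H) * (1 - ε) ^ 2 + symProb ε ph A =
      (1 - ε ^ 2 / 2) * (1 - ε) := by
    rw [hq, hA]; ring
  have hbound : ∀ s k T : ℕ, s + k ≤ T → strP (symProb ε ph) T {l | ¬ HasCatalan 0 s k l} ≤
      2 * Real.exp (-(k * (ε * μ / 8))) := by
    intro s k T hT
    have hexp : (1 - ε * μ / 8) ^ k ≤ Real.exp (-(k * (ε * μ / 8))) := by
      rw [show -(k * (ε * μ / 8)) = (k : ℝ) * (-(ε * μ / 8)) by ring, Real.exp_nat_mul]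
      refine pow_le_pow_left₀ (by linarith) ?_ k
      linarith [Real.add_one_le_exp (-(ε * μ / 8))]
    refine (strP_not_hasCatalan_le (x := 1 + μ / 4) (lam := 1 - ε * μ / 8) (φ := 1 - ε) hp
      (by linarith) (by linarith) (by linarith) (by linarith) ?_ ?_ ?_ ?_ ?_ hT).trans
      (mul_le_mul_of_nonneg_left hexp zero_le_two)
    · rw [hq, hA]
      -- Expanding `1 / x` to second order leaves the gain `ε * μ / 4`, half of which absorbs the
      -- quadratic term.
      have h1 : (1 + ε) / 2 / (1 + μ / 4) ≤ (1 + ε) / 2 * (1 - μ / 4 + (μ / 4) ^ 2) := by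
        rw [div_le_iff₀ (by linarith), mul_assoc]
        have : 1 ≤ (1 - μ / 4 + (μ / 4) ^ 2) * (1 + μ / 4) := by
          have : 0 ≤ (μ / 4) ^ 3 := by positivity
          nlinarith
        exact le_mul_of_one_le_right (by linarith) this
      have h2 : (1 + ε) / 2 * (μ / 4) ^ 2 ≤ ε * μ / 8 := by nlinarith
      nlinarith
    · rw [key, ← mul_assoc]
      refine mul_le_mul_of_nonneg_right ?_ (by linarith)
      nlinarith
    · rw [hA]
      simp only [symProb]
      nlinarith
    · rw [key]
      nlinarith
    · nlinarith
  refine (strP_not_hasCatalan_le_exp hp (by positivity) hbound hT).trans (le_of_eq ?_)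
  rw [hm]
  ring_nf

/-! ### Tines as sets of labels -/

namespace LabeledTree

variable {F : LabeledTree}

theorem isTine_tineTo (z : F.V) : F.IsTine (F.tineTo z) :=
  (F.existsUnique_path z).choose_spec.1.1

theorem getLast?_tineTo (z : F.V) : (F.tineTo z).getLast? = some z :=
  (F.existsUnique_path z).choose_spec.1.2

theorem mem_tineTo (z : F.V) : z ∈ F.tineTo z := List.mem_of_getLast? (getLast?_tineTo z)

theorem IsTine.eq_tineTo {p : List F.V} {z : F.V} (hp : F.IsTine p) (hz : p.getLast? = some z) :
    p = F.tineTo z :=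
  (F.existsUnique_path z).unique ⟨hp, hz⟩ ⟨isTine_tineTo z, getLast?_tineTo z⟩

theorem IsTine.root_mem {p : List F.V} (hp : F.IsTine p) : F.root ∈ p := List.mem_of_head? hp.1

theorem IsTine.append_singleton_eq_tineTo {p₁ p₂ : List F.V} {z : F.V}
    (hp : F.IsTine (p₁ ++ z :: p₂)) : p₁ ++ [z] = F.tineTo z := by
  refine IsTine.eq_tineTo ⟨?_, ?_⟩ (by simp)
  · have := hp.1
    cases p₁ <;> simpa using this
  · have := hp.2
    rw [← List.singleton_append, ← List.append_assoc] at this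
    exact this.left_of_append

theorem IsTine.pairwise {p : List F.V} (hp : F.IsTine p)
    (hlt : ∀ u v : F.V, F.edge u v → F.label u < F.label v) :
    p.Pairwise (fun u v => F.label u < F.label v) := by
  have : IsTrans F.V (fun u v => F.label u < F.label v) := ⟨fun _ _ _ => lt_trans⟩
  exact (hp.2.imp hlt).pairwise

theorem IsTine.nodup_map_label {p : List F.V} (hp : F.IsTine p)
    (hlt : ∀ u v : F.V, F.edge u v → F.label u < F.label v) : (p.map F.label).Nodup :=
  List.pairwise_map.2 ((hp.pairwise hlt).imp fun h => h.ne)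

theorem IsTine.eq_of_label_eq {p : List F.V} (hp : F.IsTine p)
    (hlt : ∀ u v : F.V, F.edge u v → F.label u < F.label v) {u v : F.V} (hu : u ∈ p) (hv : v ∈ p)
    (huv : F.label u = F.label v) : u = v :=
  List.inj_on_of_nodup_map (hp.nodup_map_label hlt) hu hv huv

/-- Tines through a common vertex agree up to that vertex. -/
theorem IsTine.mem_iff_mem_tineTo {p : List F.V} (hp : F.IsTine p)
    (hlt : ∀ u v : F.V, F.edge u v → F.label u < F.label v) {z w : F.V} (hz : z ∈ p)
    (hw : F.label w ≤ F.label z) : w ∈ p ↔ w ∈ F.tineTo z := by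
  obtain ⟨p₁, p₂, rfl⟩ := List.append_of_mem hz
  rw [← hp.append_singleton_eq_tineTo]
  have h1 := (List.pairwise_cons.1 (List.pairwise_append.1 (hp.pairwise hlt)).2.1).1
  simp only [List.mem_append, List.mem_cons, List.not_mem_nil, or_false]
  constructor
  · rintro (h | h | h)
    · exact Or.inl h
    · exact Or.inr h
    · exact absurd (h1 w h) (not_lt.2 hw)
  · rintro (h | h)
    · exact Or.inl h
    · exact Or.inr (Or.inl h)

/-- The set of labels on a list of vertices. -/
def labelSet (p : List F.V) : Finset ℕ := (p.map F.label).toFinset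

theorem mem_labelSet {p : List F.V} {i : ℕ} : i ∈ labelSet p ↔ ∃ z ∈ p, F.label z = i := by
  simp [labelSet]

theorem IsTine.card_labelSet {p : List F.V} (hp : F.IsTine p)
    (hlt : ∀ u v : F.V, F.edge u v → F.label u < F.label v) :
    (labelSet p).card = p.length := by
  rw [labelSet, List.toFinset_card_of_nodup (hp.nodup_map_label hlt), List.length_map]

/-- Labels on a tine are distinct and increasing, so depth is a count of smaller labels. Comparing
tines becomes counting slots. -/
theorem IsTine.depth_eq {p : List F.V} (hp : F.IsTine p)
    (hlt : ∀ u v : F.V, F.edge u v → F.label u < F.label v) {z : F.V} (hz : z ∈ p) :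
    F.depth z = ((labelSet p).filter (· < F.label z)).card := by
  have h1 : (labelSet p).filter (· < F.label z) = (labelSet (F.tineTo z)).erase (F.label z) := by
    have hle : ∀ w ∈ F.tineTo z, F.label w ≤ F.label z := by
      intro w hw
      obtain ⟨p₁, p₂, rfl⟩ := List.append_of_mem hz
      rw [← hp.append_singleton_eq_tineTo, List.mem_append, List.mem_singleton] at hw
      rcases hw with hw | rfl
      · exact ((List.pairwise_append.1 (hp.pairwise hlt)).2.2 w hw z (by simp)).le
      · exact le_rfl
    ext i
    simp only [Finset.mem_filter, Finset.mem_erase, mem_labelSet]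
    constructor
    · rintro ⟨⟨w, hw, rfl⟩, hi⟩
      exact ⟨hi.ne, w, (hp.mem_iff_mem_tineTo hlt hz hi.le).1 hw, rfl⟩
    · rintro ⟨hi, w, hw, rfl⟩
      exact ⟨⟨w, (hp.mem_iff_mem_tineTo hlt hz (hle w hw)).2 hw, rfl⟩,
        lt_of_le_of_ne (hle w hw) hi⟩
  rw [h1, Finset.card_erase_of_mem (mem_labelSet.2 ⟨z, mem_tineTo z, rfl⟩),
    (isTine_tineTo z).card_labelSet hlt]
  rfl

end LabeledTree

/-! ### Longest tines pass through Catalan slots -/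

open LabeledTree

/-- The slots whose symbol satisfies `q`. -/
def slots {n : ℕ} (w : CharString n) (q : CharSym → Bool) : Finset ℕ :=
  (Finset.univ.filter fun i : Fin n => q (w i)).image fun i : Fin n => (i : ℕ) + 1

theorem mem_slots {n : ℕ} {w : CharString n} {q : CharSym → Bool} {i : ℕ} :
    i ∈ slots w q ↔ ∃ j : Fin n, q (w j) ∧ (j : ℕ) + 1 = i := by
  simp [slots]

/-- The honest slots. -/
abbrev honestSlots {n : ℕ} (w : CharString n) : Finset ℕ := slots w (· ≠ A)

/-- The adversarial slots. -/
abbrev advSlots {n : ℕ} (w : CharString n) : Finset ℕ := slots w (· = A)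

theorem mem_honestSlots_or_mem_advSlots {n : ℕ} (w : CharString n) {i : ℕ} (h0 : 0 < i)
    (hn : i ≤ n) : i ∈ honestSlots w ∨ i ∈ advSlots w := by
  by_cases hA : w ⟨i - 1, by omega⟩ = A
  · exact Or.inr (mem_slots.2 ⟨⟨i - 1, by omega⟩, by simpa using hA, by simp; omega⟩)
  · exact Or.inl (mem_slots.2 ⟨⟨i - 1, by omega⟩, by simpa using hA, by simp; omega⟩)

theorem card_honestSlots_sub_card_advSlots {n : ℕ} (w : CharString n) {a b : ℕ} (hab : a ≤ b)
    (hb : b ≤ n) : (((Finset.Ioc a b).filter (· ∈ honestSlots w)).card : ℤ) -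
      ((Finset.Ioc a b).filter (· ∈ advSlots w)).card =
      walk ((List.ofFn w).take b) - walk ((List.ofFn w).take a) := by
  simp only [Finset.card_filter, Nat.cast_sum]
  rw [← Finset.sum_sub_distrib]
  induction b, hab using Nat.le_induction with
  | base => simp
  | succ b hab ih =>
    have hlen : b < (List.ofFn w).length := by simpa using hb
    rw [Finset.sum_Ioc_succ_top hab, ih (by omega), List.take_succ_eq_append_getElem hlen,
      walk_append, walk_cons, walk_nil, List.getElem_ofFn]
    have h1 : ∀ q : CharSym → Bool, b + 1 ∈ slots w q ↔ q (w ⟨b, hb⟩) := by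
      intro q
      rw [mem_slots]
      constructor
      · rintro ⟨j, hj, hjb⟩
        obtain rfl : j = ⟨b, hb⟩ := Fin.ext (by simpa using hjb)
        exact hj
      · exact fun hq => ⟨⟨b, hb⟩, hq, rfl⟩
    simp only [h1]
    cases w ⟨b, hb⟩ <;> simp [step] <;> ring

section Fork

variable {n : ℕ} {w : CharString n} {F : LabeledTree}

/-- The root is allowed to play the role of an honest vertex: label 0 forces depth 0, and honest
slots are positive. -/
theorem IsFork.depth_lt_depth (hF : IsFork w F) {u v : F.V}
    (hu : F.label u = 0 ∨ F.label u ∈ honestSlots w) (hv : F.label v ∈ honestSlots w)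
    (huv : F.label u < F.label v) : F.depth u < F.depth v := by
  rcases hu with hu | hu
  · rw [(isTine_tineTo u).depth_eq hF.label_lt (mem_tineTo u),
      (isTine_tineTo v).depth_eq hF.label_lt (mem_tineTo v), hu]
    simp only [Nat.not_lt_zero, Finset.filter_false, Finset.card_empty]
    refine Finset.card_pos.2 ⟨0, Finset.mem_filter.2 ⟨mem_labelSet.2
      ⟨F.root, (isTine_tineTo v).root_mem, hF.label_root⟩, by omega⟩⟩
  · obtain ⟨i, hi, hiu⟩ := mem_slots.1 hu
    obtain ⟨j, hj, hjv⟩ := mem_slots.1 hv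
    exact hF.honest_depth i j (by simpa using hi) (by simpa using hj)
      (by rw [Fin.lt_def]; omega) u v hiu.symm hjv.symm

/-- The vertices of honest slots become deeper and deeper. -/
theorem IsFork.exists_depth_ge (hF : IsFork w F) {b : F.V}
    (hb : F.label b = 0 ∨ F.label b ∈ honestSlots w) {r : ℕ} (hr : F.label b ≤ r) (hrn : r ≤ n) :
    ∃ z : F.V, (F.label z = 0 ∨ F.label z ∈ honestSlots w) ∧ F.label z ≤ r ∧
      F.depth b + ((Finset.Ioc (F.label b) r).filter (· ∈ honestSlots w)).card ≤ F.depth z := by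
  induction r, hr using Nat.le_induction with
  | base => exact ⟨b, hb, le_rfl, by simp⟩
  | succ r hr ih =>
    obtain ⟨z, h1, h2, h3⟩ := ih (by omega)
    by_cases hon : r + 1 ∈ honestSlots w
    · obtain ⟨i, hi, hir⟩ := mem_slots.1 hon
      obtain ⟨y, hy⟩ : ∃ y : F.V, F.label y = i + 1 := by
        rcases hw : w i
        · exact (hF.unique_honest i hw).exists
        · exact hF.multi_honest i hw
        · simp [hw] at hi
      rw [hir] at hy
      have h4 := hF.depth_lt_depth h1 (by rwa [hy]) (show F.label z < F.label y by omega)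
      refine ⟨y, Or.inr (by rwa [hy]), hy.le, ?_⟩
      rw [Finset.card_filter, Finset.sum_Ioc_succ_top hr, ← Finset.card_filter, if_pos hon]
      omega
    · refine ⟨z, h1, by omega, ?_⟩
      rw [Finset.card_filter, Finset.sum_Ioc_succ_top hr, ← Finset.card_filter, if_neg hon]
      omega

/-- If all intervals around the slot of the only vertex `u` with its label contain more honest
than adversarial slots, then every maximum-length tine contains `u`. -/
theorem IsFork.mem_of_isMaxTine (hF : IsFork w F) {u : F.V}
    (hu : ∀ v : F.V, F.label v = F.label u → v = u) (hu0 : 0 < F.label u)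
    (hcat : ∀ a b : ℕ, a < F.label u → F.label u ≤ b → b ≤ n →
      ((Finset.Ioc a b).filter (· ∈ advSlots w)).card <
        ((Finset.Ioc a b).filter (· ∈ honestSlots w)).card)
    {p : List F.V} (hp : F.IsMaxTine p) : u ∈ p := by
  by_contra hup
  set P := labelSet p with hP
  have hcP : F.label u ∉ P := by
    intro h
    obtain ⟨z, hz, hzc⟩ := mem_labelSet.1 h
    exact hup (hu z hzc ▸ hz)
  -- The vertex `b` is the last honest vertex of `p` before `u`, or the root.
  obtain ⟨l, hl, hlmax⟩ := Finset.exists_max_image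
    (P.filter fun i => i < F.label u ∧ (i = 0 ∨ i ∈ honestSlots w)) id
    ⟨0, Finset.mem_filter.2 ⟨mem_labelSet.2 ⟨F.root, hp.1.root_mem, hF.label_root⟩, hu0,
      Or.inl rfl⟩⟩
  obtain ⟨hlP, hlc, hlhon⟩ := Finset.mem_filter.1 hl
  obtain ⟨b, hbp, rfl⟩ := mem_labelSet.1 hlP
  -- Past `b`, and before the next honest vertex, `p` meets only adversarial slots. Here `r` is the
  -- label of that vertex, or `n + 1` if there is none; the summand 1 counts `b` itself.
  have upper : ∀ r, F.label u < r → r ≤ n + 1 →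
      (∀ i ∈ P, F.label u < i → i < r → i ∉ honestSlots w) →
      (P.filter (· < r)).card ≤
        F.depth b + 1 + ((Finset.Ioc (F.label b) (r - 1)).filter (· ∈ advSlots w)).card := by
    intro r hr hrn hno
    rw [hp.1.depth_eq hF.label_lt hbp, ← hP]
    have hsub : P.filter (· < r) ⊆ (P.filter (· < F.label b) ∪ {F.label b}) ∪
        (Finset.Ioc (F.label b) (r - 1)).filter (· ∈ advSlots w) := by
      intro i hi
      obtain ⟨hiP, hir⟩ := Finset.mem_filter.1 hi
      simp only [Finset.mem_union, Finset.mem_filter, Finset.mem_singleton, Finset.mem_Ioc]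
      rcases lt_trichotomy i (F.label b) with h | h | h
      · exact Or.inl (Or.inl ⟨hiP, h⟩)
      · exact Or.inl (Or.inr h)
      · refine Or.inr ⟨⟨h, by omega⟩, ?_⟩
        refine (mem_honestSlots_or_mem_advSlots w (by omega) (by omega)).resolve_left fun hon => ?_
        rcases lt_trichotomy i (F.label u) with h' | h' | h'
        · exact absurd (hlmax i (Finset.mem_filter.2 ⟨hiP, h', Or.inr hon⟩)) (not_le.2 h)
        · exact hcP (h' ▸ hiP)
        · exact hno i hiP h' hir hon
    refine (Finset.card_le_card hsub).trans ((Finset.card_union_le _ _).trans ?_)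
    gcongr
    exact (Finset.card_union_le _ _).trans (by simp)
  have hun := hF.label_le u
  rcases (P.filter fun i => F.label u < i ∧ i ∈ honestSlots w).eq_empty_or_nonempty with he | hne
  -- No honest vertex follows on `p`: some honest vertex is then deeper than the end of `p`,
  -- contradicting maximality.
  · have h1 := upper (n + 1) (by omega) le_rfl fun i hi hci _ hon =>
      Finset.notMem_empty i (he ▸ Finset.mem_filter.2 ⟨hi, hci, hon⟩)
    obtain ⟨z, -, -, hz⟩ := hF.exists_depth_ge hlhon (show F.label b ≤ n by omega) le_rfl
    have h2 := hcat (F.label b) n hlc hun le_rfl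
    have h3 : (P.filter (· < n + 1)).card = p.length := by
      rw [← hp.1.card_labelSet hF.label_lt, Finset.filter_true_of_mem]
      intro i hi
      obtain ⟨v, -, rfl⟩ := mem_labelSet.1 hi
      have := hF.label_le v
      omega
    have h4 : F.depth z ≤ p.length - 1 := hp.2 _ (isTine_tineTo z)
    have h5 : n + 1 - 1 = n := rfl
    rw [h5] at h1
    omega
  -- The next honest vertex `y` must be deeper than the honest vertices before it, but `p` has too
  -- few vertices to reach that depth.
  · obtain ⟨r, hr, hrmin⟩ := Finset.exists_min_image _ id hne
    obtain ⟨hrP, hcr, hron⟩ := Finset.mem_filter.1 hr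
    obtain ⟨y, hyp, rfl⟩ := mem_labelSet.1 hrP
    have hyn := hF.label_le y
    have h1 := upper (F.label y) hcr (by omega) fun i hi hci hir hon =>
      absurd (hrmin i (Finset.mem_filter.2 ⟨hi, hci, hon⟩)) (not_le.2 hir)
    obtain ⟨z, hz1, hz2, hz⟩ := hF.exists_depth_ge hlhon
      (show F.label b ≤ F.label y - 1 by omega) (by omega)
    have h2 := hcat (F.label b) (F.label y - 1) hlc (by omega) (by omega)
    have h3 := hF.depth_lt_depth hz1 hron (by omega)
    rw [hp.1.depth_eq hF.label_lt hyp, ← hP] at h3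
    omega

theorem IsFork.not_hasDivergingMaxTines (hF : IsFork w F) {s k : ℕ}
    (hw : HasCatalan 0 s k (List.ofFn w)) : ¬ F.HasDivergingMaxTines s := by
  obtain ⟨l₁, l₂, he, hs, -, hmax, -, hstay⟩ := hw
  have hlen : n = l₁.length + (l₂.length + 1) := by simpa using congrArg List.length he
  have hwh : w ⟨l₁.length, by omega⟩ = h := by
    have : (List.ofFn w)[l₁.length]? = some h := by rw [he]; simp
    rw [List.getElem?_ofFn, dif_pos (by omega)] at this
    exact Option.some.inj this
  obtain ⟨u, hu, huniq⟩ := hF.unique_honest _ hwh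
  simp only at hu huniq
  have hcat : ∀ a b : ℕ, a < F.label u → F.label u ≤ b → b ≤ n →
      ((Finset.Ioc a b).filter (· ∈ advSlots w)).card <
        ((Finset.Ioc a b).filter (· ∈ honestSlots w)).card := by
    intro a b ha hb hbn
    rw [hu] at ha hb
    have h1 := card_honestSlots_sub_card_advSlots w (show a ≤ b by omega) hbn
    have h2 : walk ((List.ofFn w).take a) ≤ walk l₁ := by
      rw [he, List.take_append_of_le_length (by omega)]
      have h3 := hmax _ (List.drop_suffix a l₁)
      have h4 := congrArg walk (List.take_append_drop a l₁)
      rw [walk_append] at h4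
      omega
    have h3 : walk l₁ + 1 ≤ walk ((List.ofFn w).take b) := by
      obtain ⟨m, rfl⟩ := Nat.exists_eq_add_of_le hb
      rw [he, show l₁.length + 1 + m = l₁.length + (m + 1) by ring, List.take_length_add_append,
        List.take_succ_cons, walk_append, walk_cons]
      have := hstay _ (List.take_prefix m l₂)
      simp only [step]
      omega
    omega
  rintro ⟨p, q, hp, hq, hdiv⟩
  have hup := hF.mem_of_isMaxTine (fun v hv => huniq v (hv.trans hu)) (by omega) hcat hp
  have huq := hF.mem_of_isMaxTine (fun v hv => huniq v (hv.trans hu)) (by omega) hcat hq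
  -- The Catalan vertex has label `l₁.length + 1 > s`, so both tines agree at slot `s`.
  have hpq : ∀ v, F.label v = s → (v ∈ p ↔ v ∈ q) := fun v hv =>
    (hp.1.mem_iff_mem_tineTo hF.label_lt hup (by omega)).trans
      (hq.1.mem_iff_mem_tineTo hF.label_lt huq (by omega)).symm
  rcases hdiv with ⟨x, hx, y, hy, hxs, hys, hne⟩ | ⟨⟨x, hx, hxs⟩, hno⟩ | ⟨⟨y, hy, hys⟩, hno⟩
  · exact hne (hp.1.eq_of_label_eq hF.label_lt hx ((hpq y hys).2 hy) (hxs.trans hys.symm))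
  · exact hno ⟨x, (hpq x hxs).1 hx, hxs⟩
  · exact hno ⟨y, (hpq y hys).2 hy, hys⟩

/-- A prefix of length at least `s + k` contains the Catalan slot, which stays Catalan after
truncation. -/
theorem isSettled_of_hasCatalan {T s k : ℕ} {w : CharString T}
    (hw : HasCatalan 0 s k (List.ofFn w)) : IsSettled s k w := by
  intro t ht hst F hF
  refine hF.not_hasDivergingMaxTines (k := k) ?_
  rw [Fin.ofFn_take_eq_take_ofFn]
  rw [← List.take_append_drop t (List.ofFn w)] at hw
  exact hw.of_append_right (by simp; omega)

end Fork

/-! ### From measures on strings to list expectations -/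

theorem CharSym.sum_univ (f : CharSym → ℝ) : ∑ a, f a = f h + f H + f A := by
  have : (Finset.univ : Finset CharSym) = {h, H, A} := rfl
  rw [this, Finset.sum_insert (by decide), Finset.sum_insert (by decide), Finset.sum_singleton,
    add_assoc]

theorem sum_prod_mul_ofFn (p : CharSym → ℝ) (n : ℕ) (f : List CharSym → ℝ) :
    ∑ w : CharString n, (∏ i, p (w i)) * f (List.ofFn w) = strE p n f := by
  induction n generalizing f with
  | zero => simp [strE]
  | succ n ih =>
    rw [← (Fin.consEquiv fun _ : Fin (n + 1) => CharSym).sum_comp, Fintype.sum_prod_type,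
      CharSym.sum_univ]
    have hcons : ∀ (a : CharSym) (w : CharString n),
        List.ofFn (Fin.consEquiv (fun _ : Fin (n + 1) => CharSym) (a, w)) = a :: List.ofFn w :=
      fun a w => List.ofFn_cons a w
    simp only [strE, ← ih, Finset.mul_sum, hcons]
    simp only [Fin.consEquiv_apply, Fin.prod_univ_succ, Fin.cons_zero, Fin.cons_succ, mul_assoc]

theorem BernoulliCondition.real_singleton {T : ℕ} {ε ph : ℝ} {B : Measure (CharString T)}
    (hB : BernoulliCondition ε ph B) (w : CharString T) :
    B.real {w} = ∏ i, symProb ε ph (w i) := by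
  have h1 : ({w} : Set (CharString T)) = ⋂ i, {w' | w' i = w i} := by
    ext w'
    simp [funext_iff]
  have h2 := hB.1.meas_iInter (s := fun i => {w' | w' i = w i})
    fun i => ⟨{w i}, trivial, rfl⟩
  rw [measureReal_def, h1, h2, ENNReal.toReal_prod]
  exact Finset.prod_congr rfl fun i _ => hB.2 i (w i)

theorem BernoulliCondition.real_eq_strP {T : ℕ} {ε ph : ℝ} {B : Measure (CharString T)}
    [IsProbabilityMeasure B] (hB : BernoulliCondition ε ph B) (S : Set (List CharSym)) :
    B.real {w | List.ofFn w ∈ S} = strP (symProb ε ph) T S := by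
  classical
  have h1 : ({w | List.ofFn w ∈ S} : Set (CharString T)) =
      ((Finset.univ.filter fun w : CharString T => List.ofFn w ∈ S : Finset _) :
        Set (CharString T)) := by
    ext w
    simp
  rw [h1, ← sum_measureReal_singleton, Finset.sum_filter, strP, ← sum_prod_mul_ofFn]
  refine Finset.sum_congr rfl fun w _ => ?_
  rw [hB.real_singleton, Set.indicator_apply]
  split_ifs <;> simp

theorem BernoulliCondition.settlementInsecurity_le {T : ℕ} {ε ph : ℝ}
    {B : Measure (CharString T)} [IsProbabilityMeasure B] (hB : BernoulliCondition ε ph B)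
    (hε0 : 0 < ε) (hε1 : ε < 1) (hph0 : 0 < ph) (hph : ph ≤ (1 + ε) / 2) (s k : ℕ) :
    settlementInsecurity s k B ≤
      Real.exp (-((k : ℝ) * (1 / 64 * min (ε ^ 3) (ε ^ 2 * ph)))) := by
  rcases le_or_gt (s + k) T with hT | hT
  · refine le_trans ?_ (strP_symProb_not_hasCatalan_le hε0 hε1 hph0 hph hT)
    rw [← hB.real_eq_strP]
    exact measureReal_mono fun w hw hw' => hw (isSettled_of_hasCatalan hw')
  · have : {w : CharString T | ¬ IsSettled s k w} = ∅ := by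
      refine Set.eq_empty_of_forall_notMem fun w hw => hw fun t ht hst => ?_
      omega
    rw [settlementInsecurity, this, measureReal_empty]
    positivity

/-! ### Monotonicity and stochastic dominance -/

theorem CharSym.eq_h_of_le {a b : CharSym} (hab : a ≤ b) (hb : b = h) : a = h := by
  subst hb
  revert hab
  cases a <;> decide

theorem CharSym.ne_A_of_le {a b : CharSym} (hab : a ≤ b) (hb : b ≠ A) : a ≠ A := by
  revert hab hb
  cases a <;> cases b <;> decide

/-- Forks for a string are forks for every larger string. -/
theorem IsFork.mono {n : ℕ} {w w' : CharString n} {F : LabeledTree} (hF : IsFork w F)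
    (hw : w ≤ w') : IsFork w' F where
  label_le := hF.label_le
  label_root := hF.label_root
  label_lt := hF.label_lt
  unique_honest i hi := hF.unique_honest i (CharSym.eq_h_of_le (hw i) hi)
  multi_honest i hi := by
    have hA : w i ≠ A := CharSym.ne_A_of_le (hw i) (by simp [hi])
    rcases hwi : w i
    · exact (hF.unique_honest i hwi).exists
    · exact hF.multi_honest i hwi
    · exact absurd hwi hA
  honest_depth i j hi hj :=
    hF.honest_depth i j (CharSym.ne_A_of_le (hw i) hi) (CharSym.ne_A_of_le (hw j) hj)

/-- A fork witnessing that a string is not settled remains a witness for every larger string. -/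
theorem isUpperSet_not_isSettled (T s k : ℕ) :
    IsUpperSet {w : CharString T | ¬ IsSettled s k w} := by
  intro w w' hw hns hs
  exact hns fun t ht hst F hF => hs t ht hst F (hF.mono fun i => hw (Fin.castLE ht i))

theorem DominatedBy.settlementInsecurity_le {T : ℕ} {W B : Measure (CharString T)}
    [IsProbabilityMeasure B] (hWB : DominatedBy W B) (s k : ℕ) :
    settlementInsecurity s k W ≤ settlementInsecurity s k B :=
  ENNReal.toReal_mono (measure_ne_top _ _)
    (hWB _ (Set.toFinite _).measurableSet (isUpperSet_not_isSettled T s k))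

end Settlement

theorem theorem1 :
    ∃ c : ℝ, 0 < c ∧
      ∀ (ε ph : ℝ), 0 < ε → ε < 1 → 0 < ph → ph < 1 → ph ≤ (1 + ε) / 2 →
      ∀ (s k T : ℕ) (B : Measure (Settlement.CharString T)), IsProbabilityMeasure B →
        Settlement.BernoulliCondition ε ph B →
        Settlement.settlementInsecurity s k B
            ≤ Real.exp (-((k : ℝ) * (c * min (ε ^ 3) (ε ^ 2 * ph)))) ∧
        ∀ W : Measure (Settlement.CharString T), IsProbabilityMeasure W →
          Settlement.DominatedBy W B →
          Settlement.settlementInsecurity s k W ≤ Settlement.settlementInsecurity s k B :=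
  ⟨1 / 64, by norm_num, fun _ _ hε0 hε1 hph0 _ hph s k _ _ _ hB =>
    ⟨hB.settlementInsecurity_le hε0 hε1 hph0 hph s k,
      fun _ _ hWB => hWB.settlementInsecurity_le s k⟩⟩
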